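/- Let $K$ be a field of characteristic zero, let $a_0(x),a_1(x),a_2(x)\in K[x]$, and let $$D=y\,\partial_x+\bigl(a_2(x)y^2+a_1(x)y+a_0(x)\bigr)\,\partial_y ,$$ a $K$-derivation of the polynomial ring $K[x,y]$. Call $D$ simple if the only ideals $I$ of $K[x,y]$ with $D(I)\subseteq I$ are $0$ and $K[x,y]$. Write $K^*=K\setminus\{0\}$, and set $\deg 0=-\infty$. Then $D$ is simple if and only if the following three conditions all hold: 1. $a_0(x)\in K^*$ (that is, $a_0$ is a nonzero constant); 2. $\deg a_1(x)\ge 1$ or $\deg a_2(x)\ge 1$; 3. there is no $l\in K^*$ such that $a_2(x)=l\,a_1(x)-l^2a_0(x)$. -/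

import Mathlib

/-- An ideal `I` of `R` is `D`-stable if `D(I) ⊆ I`. -/
def IsStableIdeal {K R : Type*} [CommRing K] [CommRing R] [Algebra K R]
    (D : Derivation K R R) (I : Ideal R) : Prop :=
  ∀ f ∈ I, D f ∈ I

/-- A `K`-derivation `D` of `R` is simple if `R` has no `D`-stable ideal other than `0` and `R`. -/
def IsSimpleDerivation {K R : Type*} [CommRing K] [CommRing R] [Algebra K R]
    (D : Derivation K R R) : Prop :=
  ∀ I : Ideal R, IsStableIdeal D I → I = ⊥ ∨ I = ⊤

/-- The derivation `y ∂_x + (a₂(x) y² + a₁(x) y + a₀(x)) ∂_y` of `K[x, y]`, where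
`x = X 0` and `y = X 1`. -/
noncomputable def quadraticDerivation {K : Type*} [Field K] (a₀ a₁ a₂ : Polynomial K) :
    Derivation K (MvPolynomial (Fin 2) K) (MvPolynomial (Fin 2) K) :=
  (MvPolynomial.X 1 : MvPolynomial (Fin 2) K) • MvPolynomial.pderiv 0 +
    (Polynomial.aeval (MvPolynomial.X 0 : MvPolynomial (Fin 2) K) a₂ * MvPolynomial.X 1 ^ 2 +
      Polynomial.aeval (MvPolynomial.X 0 : MvPolynomial (Fin 2) K) a₁ * MvPolynomial.X 1 +
      Polynomial.aeval (MvPolynomial.X 0 : MvPolynomial (Fin 2) K) a₀) • MvPolynomial.pderiv 1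

/-!
The derivation is moved to the iterated polynomial ring `K[x][y]`. Necessity is the exhibition of a
proper nonzero stable ideal whenever a condition fails: `(y, a₀)` if `a₀` is not a nonzero constant;
the ideal of `a₂ y² + a₁ y + c` or, if `a₁ = a₂ = 0`, of `y² - 2 c x` if all coefficients are
constant; the ideal of the line `1 + l y` if `a₂ = l a₁ - l² c`.

For sufficiency, let `a₀ = c` be a nonzero constant and suppose that `D` is not simple. In
characteristic zero the largest stable ideal inside a prime ideal is prime (`stableCore_isPrime`),
so there is a nonzero stable prime ideal. It meets `K[x]` trivially, since otherwise it would
contain `y`, hence `D y`, hence `c`. By Gauss's lemma it then contains an irreducible `f`, monic in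
`y`, with `D f = (n a₂ y + k) f`, where `n` is the degree in `y` and `k ∈ K[x]`
(`exists_monic_irreducible_dvd`, `exists_cofactor`).

The roots `yᵢ` of `f` in an algebraic closure of `K(x)` satisfy `yᵢ yᵢ' = a₂ yᵢ² + a₁ yᵢ + c`. They
are distinct and nonzero, and the logarithmic derivative of `∏_{i ≠ j} (yᵢ - yⱼ) / ∏ yᵢ` turns out
to be the polynomial `n (n - 2) a₂ - k (k - a₁) / c`. A nonzero algebraic function cannot have a
nonzero polynomial as its logarithmic derivative, so `c n (n - 2) a₂ = k (k - a₁)`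
(`cofactor_identity`).

What remains is elementary. Comparing coefficients of powers of `y` in `D f = (n a₂ y + k) f` gives
a three-term recurrence for the coefficients of `f` (`InvariantCoeffs`). For `n = 1` it says that
`f` is proportional to some `1 + l y`, which the third condition excludes. For `n ≥ 2` the identity
and the degrees in `x` contradict each other: if `a₂ = 0` then `k` is `0` or `a₁` and the recurrence
determines the degrees of all coefficients (`InvariantCoeffs.false_of_eq_zero`); if `a₂ ≠ 0` and
`n = 2` then `a₂` and the constant coefficient of `f` are constants
(`InvariantCoeffs.false_of_eq_two`); if `a₂ ≠ 0` and `n ≥ 3` then `k` or `k - a₁` and the trace of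
`f` are constants (`InvariantCoeffs.false_of_three_le`).
-/

/-! ### Stable prime ideals -/

section StablePrime

variable {K R : Type*} [CommRing K] [CommRing R] [Algebra K R]

theorem Derivation.iterate_mul (D : Derivation K R R) (n : ℕ) (f g : R) :
    D^[n] (f * g) =
      ∑ ij ∈ Finset.HasAntidiagonal.antidiagonal n, n.choose ij.1 • (D^[ij.1] f * D^[ij.2] g) := by
  induction n generalizing f g with
  | zero => simp
  | succ n ih =>
    rw [Finset.sum_antidiagonal_choose_succ_nsmul (fun i j => D^[i] f * D^[j] g) n,
      Function.iterate_succ_apply, D.leibniz, smul_eq_mul, smul_eq_mul, mul_comm g (D f),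
      iterate_map_add, ih, ih]
    congr 1
    refine Finset.sum_congr rfl fun ij hij => ?_
    rw [Nat.choose_symm_of_eq_add (Finset.HasAntidiagonal.mem_antidiagonal.1 hij).symm]
    rfl

/-- The largest `D`-stable ideal contained in `P`: the elements all of whose iterated derivatives
lie in `P`. -/
def stableCore (D : Derivation K R R) (P : Ideal R) : Ideal R where
  carrier := {f | ∀ k, D^[k] f ∈ P}
  zero_mem' k := by simp [iterate_map_zero]
  add_mem' ha hb k := by
    rw [iterate_map_add]
    exact P.add_mem (ha k) (hb k)
  smul_mem' r f hf k := by
    rw [smul_eq_mul, D.iterate_mul]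
    exact P.sum_mem fun ij _ => P.nsmul_mem (P.mul_mem_left _ (hf _)) _

theorem stableCore_stable (D : Derivation K R R) (P : Ideal R) :
    IsStableIdeal D (stableCore D P) :=
  fun _ hf k => hf (k + 1)

theorem stableCore_le (D : Derivation K R R) (P : Ideal R) : stableCore D P ≤ P :=
  fun _ hf => hf 0

theorem IsStableIdeal.le_stableCore {D : Derivation K R R} {I P : Ideal R}
    (hI : IsStableIdeal D I) (h : I ≤ P) : I ≤ stableCore D P := by
  intro f hf k
  apply h
  induction k generalizing f with
  | zero => exact hf
  | succ k ih => exact ih (hI f hf)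

/-- In characteristic zero the largest stable ideal inside a prime is prime: if `k` and `l` are the
orders at which the derivatives of `f` and `g` leave `P`, then modulo `P` the Leibniz rule for
`D^(k+l) (f g)` has the single surviving term `(k+l choose k) D^k f D^l g`. -/
theorem stableCore_isPrime [Algebra ℚ R] (D : Derivation K R R) (P : Ideal R) [hP : P.IsPrime] :
    (stableCore D P).IsPrime := by
  refine ⟨fun h => hP.ne_top (top_le_iff.1 (h ▸ stableCore_le D P)), fun {f g} hfg => ?_⟩
  by_contra! hcon
  obtain ⟨hf, hg⟩ := hcon
  have hf' : ∃ k, D^[k] f ∉ P := by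
    by_contra! h
    exact hf h
  have hg' : ∃ k, D^[k] g ∉ P := by
    by_contra! h
    exact hg h
  classical
  have hk := Nat.find_spec hf'
  have hl := Nat.find_spec hg'
  have hk' := fun m => Nat.find_min hf' (m := m)
  have hl' := fun m => Nat.find_min hg' (m := m)
  set k := Nat.find hf'
  set l := Nat.find hg'
  have h := hfg (k + l)
  have hkl : (k, l) ∈ Finset.HasAntidiagonal.antidiagonal (k + l) :=
    Finset.HasAntidiagonal.mem_antidiagonal.2 rfl
  rw [D.iterate_mul, ← Finset.add_sum_erase _ _ hkl] at h
  have hrest : ∑ ij ∈ (Finset.HasAntidiagonal.antidiagonal (k + l)).erase (k, l),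
      (k + l).choose ij.1 • (D^[ij.1] f * D^[ij.2] g) ∈ P := by
    refine P.sum_mem fun ij hij => P.nsmul_mem ?_ _
    obtain ⟨hne, hij⟩ := Finset.mem_erase.1 hij
    rw [Finset.HasAntidiagonal.mem_antidiagonal] at hij
    rcases lt_trichotomy ij.1 k with h1 | h1 | h1
    · exact P.mul_mem_right _ (not_not.1 (hk' _ h1))
    · exact absurd (Prod.ext h1 (by simp; omega)) hne
    · exact P.mul_mem_left _ (not_not.1 (hl' _ (by omega)))
  have hmain := (P.add_mem_iff_left hrest).1 h
  have hu : IsUnit (((k + l).choose k : ℕ) : R) := by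
    have : ((k + l).choose k : ℚ) ≠ 0 :=
      Nat.cast_ne_zero.2 (Nat.choose_pos (Nat.le_add_right k l)).ne'
    simpa using (IsUnit.mk0 _ this).map (algebraMap ℚ R)
  rw [nsmul_eq_mul, P.unit_mul_mem_iff_mem hu] at hmain
  exact (hP.mem_or_mem hmain).elim hk hl

/-- Over a `ℚ`-algebra simplicity only has to be tested on prime ideals. -/
theorem isSimpleDerivation_of_isPrime [Algebra ℚ R] (D : Derivation K R R)
    (h : ∀ P : Ideal R, P.IsPrime → IsStableIdeal D P → P = ⊥) : IsSimpleDerivation D := by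
  intro I hI
  by_cases hI' : I = ⊤
  · exact Or.inr hI'
  · obtain ⟨M, hM, hIM⟩ := I.exists_le_maximal hI'
    have := hM.isPrime
    refine Or.inl (le_bot_iff.1 ?_)
    rw [← h _ (stableCore_isPrime D M) (stableCore_stable D M)]
    exact hI.le_stableCore hIM

theorem IsSimpleDerivation.of_ringEquiv {S : Type*} [CommRing S] [Algebra K S] (e : R ≃+* S)
    {D : Derivation K R R} {D' : Derivation K S S} (h : ∀ f, e (D f) = D' (e f))
    (hD : IsSimpleDerivation D) : IsSimpleDerivation D' := by
  intro I hI
  have hs : IsStableIdeal D (I.comap e) := fun f hf => by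
    rw [Ideal.mem_comap] at hf ⊢
    rw [h]
    exact hI _ hf
  have hmap : (I.comap e).map e = I := Ideal.map_comap_of_surjective e e.surjective I
  rcases hD _ hs with h0 | h0
  · left
    rw [← hmap, h0, Ideal.map_bot]
  · right
    rw [← hmap, h0, Ideal.map_top]

end StablePrime

/-! ### The derivation in iterated polynomial rings -/

section Bivariate

open Polynomial Polynomial.Bivariate

variable {K : Type*} [Field K]

/-- The partial derivative `∂/∂x` of `K[x][y]`: differentiation of the coefficients. -/
noncomputable def coeffDerivative : Derivation K K[X][Y] K[X][Y] :=
  PolynomialModule.equivPolynomialSelf.compDer (derivative' (R := K)).mapCoeffs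

@[simp]
theorem coeff_coeffDerivative (f : K[X][Y]) (i : ℕ) :
    (coeffDerivative f).coeff i = derivative (f.coeff i) := rfl

/-- The derivation `y ∂_x + (a₂ y² + a₁ y + a₀) ∂_y` of `K[x][y]`. -/
noncomputable def bivariateDerivation (a₀ a₁ a₂ : K[X]) : Derivation K K[X][Y] K[X][Y] :=
  (X : K[X][Y]) • coeffDerivative +
    (C a₂ * X ^ 2 + C a₁ * X + C a₀ : K[X][Y]) • (derivative' (R := K[X])).restrictScalars K

theorem bivariateDerivation_apply (a₀ a₁ a₂ : K[X]) (f : K[X][Y]) :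
    bivariateDerivation a₀ a₁ a₂ f =
      X * coeffDerivative f + (C a₂ * X ^ 2 + C a₁ * X + C a₀) * derivative f := rfl

theorem bivariateDerivation_X (a₀ a₁ a₂ : K[X]) :
    bivariateDerivation a₀ a₁ a₂ X = C a₂ * X ^ 2 + C a₁ * X + C a₀ := by
  have : coeffDerivative (X : K[X][Y]) = 0 := by
    ext i : 1
    simp only [coeff_coeffDerivative, coeff_X, coeff_zero]
    split_ifs <;> simp
  simp [bivariateDerivation_apply, this]

theorem bivariateDerivation_C (a₀ a₁ a₂ p : K[X]) :
    bivariateDerivation a₀ a₁ a₂ (C p) = C (derivative p) * X := by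
  have : coeffDerivative (C p) = C (derivative p) := by
    ext i : 1
    simp only [coeff_coeffDerivative, coeff_C]
    split_ifs <;> simp
  rw [bivariateDerivation_apply, this, derivative_C, mul_zero, add_zero, mul_comm]

theorem equivMvPolynomial_bivariateDerivation (a₀ a₁ a₂ : K[X]) (f : K[X][Y]) :
    equivMvPolynomial K (bivariateDerivation a₀ a₁ a₂ f) =
      quadraticDerivation a₀ a₁ a₂ (equivMvPolynomial K f) := by
  have hC (p : K[X]) : equivMvPolynomial K (C p) = aeval (MvPolynomial.X 0) p := by
    induction p using Polynomial.induction_on' with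
    | add p q hp hq => simp [hp, hq]
    | monomial n a => simp [← C_mul_X_pow_eq_monomial, MvPolynomial.algebraMap_eq]
  simp only [bivariateDerivation_apply, quadraticDerivation, Derivation.add_apply,
    Derivation.smul_apply, pderiv_zero_equivMvPolynomial, pderiv_one_equivMvPolynomial, map_add,
    map_mul, map_pow, hC, equivMvPolynomial_X, smul_eq_mul]
  rfl

theorem isSimpleDerivation_quadraticDerivation_iff (a₀ a₁ a₂ : K[X]) :
    IsSimpleDerivation (quadraticDerivation a₀ a₁ a₂) ↔
      IsSimpleDerivation (bivariateDerivation a₀ a₁ a₂) := by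
  refine ⟨fun h => h.of_ringEquiv (equivMvPolynomial K).symm.toRingEquiv fun f => ?_,
    fun h => h.of_ringEquiv (equivMvPolynomial K).toRingEquiv fun f =>
      equivMvPolynomial_bivariateDerivation a₀ a₁ a₂ f⟩
  apply (equivMvPolynomial K).injective
  simp [equivMvPolynomial_bivariateDerivation]

end Bivariate

/-! ### Necessity of the conditions -/

section Necessity

open Polynomial

theorem isStableIdeal_span {K R : Type*} [CommRing K] [CommRing R] [Algebra K R]
    {D : Derivation K R R} {s : Set R} (h : ∀ g ∈ s, D g ∈ Ideal.span s) :
    IsStableIdeal D (Ideal.span s) := by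
  intro f hf
  induction hf using Submodule.span_induction with
  | mem g hg => exact h g hg
  | zero => simp
  | add f g _ _ hf hg => rw [map_add]; exact add_mem hf hg
  | smul r f hf' hf =>
    rw [smul_eq_mul, D.leibniz, smul_eq_mul, smul_eq_mul]
    exact add_mem (Ideal.mul_mem_left _ _ hf) (Ideal.mul_mem_right _ _ hf')

/-- A simple derivation has no Darboux elements other than zero and the units. -/
theorem IsSimpleDerivation.isUnit_of_dvd {K R : Type*} [CommRing K] [CommRing R] [Algebra K R]
    {D : Derivation K R R} (hD : IsSimpleDerivation D) {g : R} (hg : g ≠ 0) (h : g ∣ D g) :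
    IsUnit g := by
  rcases hD (Ideal.span {g}) (isStableIdeal_span (by simpa [Ideal.mem_span_singleton] using h))
    with h | h
  · exact absurd (Ideal.span_singleton_eq_bot.1 h) hg
  · exact Ideal.span_singleton_eq_top.1 h

open Polynomial.Bivariate

variable {K : Type*} [Field K] {a₀ a₁ a₂ : K[X]}

theorem exists_eq_C_of_isSimpleDerivation
    (hD : IsSimpleDerivation (bivariateDerivation a₀ a₁ a₂)) :
    ∃ c : K, c ≠ 0 ∧ a₀ = C c := by
  have hX : (X : K[X][Y]) ∈ Ideal.span {X, C a₀} := Ideal.subset_span (by simp)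
  have hC : (C a₀ : K[X][Y]) ∈ Ideal.span {X, C a₀} := Ideal.subset_span (by simp)
  -- The ideal `(y, a₀)` is stable.
  have hs : IsStableIdeal (bivariateDerivation a₀ a₁ a₂) (Ideal.span {X, C a₀}) := by
    refine isStableIdeal_span fun g hg => ?_
    rcases hg with rfl | rfl
    · rw [bivariateDerivation_X, pow_two, ← mul_assoc]
      exact add_mem (add_mem (Ideal.mul_mem_left _ _ hX) (Ideal.mul_mem_left _ _ hX)) hC
    · rw [bivariateDerivation_C]
      exact Ideal.mul_mem_left _ _ hX
  rcases hD _ hs with h | h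
  · rw [h, Ideal.mem_bot] at hX
    exact absurd hX X_ne_zero
  · obtain ⟨p, q, hpq⟩ := Ideal.mem_span_pair.1 (h ▸ Submodule.mem_top : (1 : K[X][Y]) ∈ _)
    have h0 : q.coeff 0 * a₀ = 1 := by simpa using congrArg (fun f => coeff f 0) hpq
    obtain ⟨c, hc, hc'⟩ := Polynomial.isUnit_iff.1 (IsUnit.of_mul_eq_one_right _ h0)
    exact ⟨c, hc.ne_zero, hc'.symm⟩

theorem one_le_degree_of_isSimpleDerivation {c : K} (hc : c ≠ 0)
    (hD : IsSimpleDerivation (bivariateDerivation (C c) a₁ a₂)) :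
    1 ≤ a₁.degree ∨ 1 ≤ a₂.degree := by
  by_contra! hdeg
  obtain ⟨h1, h2⟩ := hdeg
  have h1 := eq_C_of_degree_le_zero (Nat.WithBot.lt_one_iff_le_zero.1 h1)
  have h2 := eq_C_of_degree_le_zero (Nat.WithBot.lt_one_iff_le_zero.1 h2)
  generalize a₁.coeff 0 = b₁ at h1
  generalize a₂.coeff 0 = b₂ at h2
  subst h1 h2
  -- If `a₁` and `a₂` are constant, the coefficient of `∂_y` is a Darboux polynomial.
  have hq0 : (C (C b₂) * X ^ 2 + C (C b₁) * X + C (C c) : K[X][Y]).coeff 0 = C c := by simp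
  have hq1 : (C (C b₂) * X ^ 2 + C (C b₁) * X + C (C c) : K[X][Y]).coeff 1 = C b₁ := by
    simp [coeff_C]
  have hq2 : (C (C b₂) * X ^ 2 + C (C b₁) * X + C (C c) : K[X][Y]).coeff 2 = C b₂ := by simp
  obtain ⟨r, -, hr⟩ := Polynomial.isUnit_iff.1 (hD.isUnit_of_dvd
    (g := C (C b₂) * X ^ 2 + C (C b₁) * X + C (C c))
    (fun h => hc (by simpa [h] using hq0.symm)) (by
      have : coeffDerivative (C (C b₂) * X ^ 2 + C (C b₁) * X + C (C c) : K[X][Y]) = 0 := by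
        ext i : 1
        simp only [coeff_coeffDerivative, coeff_add, coeff_C_mul, coeff_C, coeff_X, coeff_X_pow,
          coeff_zero]
        split_ifs <;> simp
      rw [bivariateDerivation_apply, this, mul_zero, zero_add]
      exact Dvd.intro _ rfl))
  have hb1 : b₁ = 0 := by simpa [← hr, coeff_C] using hq1.symm
  have hb2 : b₂ = 0 := by simpa [← hr, coeff_C] using hq2.symm
  subst hb1 hb2
  -- If they vanish, `y² - 2cx` is a first integral.
  have hg1 : (X ^ 2 - C (C (c + c) * X) : K[X][Y]).coeff 2 = 1 := by simp
  obtain ⟨r, -, hr⟩ := Polynomial.isUnit_iff.1 (hD.isUnit_of_dvd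
    (g := X ^ 2 - C (C (c + c) * X)) (fun h => by rw [h] at hg1; simp at hg1) (by
      rw [map_sub, bivariateDerivation_C, Derivation.leibniz_pow, bivariateDerivation_X]
      convert dvd_zero _
      simp
      ring))
  rw [← hr] at hg1
  simp at hg1

theorem ne_of_isSimpleDerivation {c l : K} (hl : l ≠ 0)
    (hD : IsSimpleDerivation (bivariateDerivation (C c) a₁ a₂)) :
    a₂ ≠ C l * a₁ - C (l ^ 2) * C c := by
  rintro rfl
  have h1 : (C (C l) * X + 1 : K[X][Y]).coeff 1 = C l := by simp [coeff_one]
  have hl' : (C l : K[X]) * C l⁻¹ = 1 := by rw [← C_mul, mul_inv_cancel₀ hl, C_1]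
  -- The line `1 + l y = 0` is invariant.
  obtain ⟨r, -, hr⟩ := Polynomial.isUnit_iff.1 (hD.isUnit_of_dvd (g := C (C l) * X + 1)
    (fun h => hl (by simpa [h] using h1.symm))
    ⟨C (C l * a₁ - C (l ^ 2) * C c) * X + C (C l * C c), by
      simp [bivariateDerivation_X, bivariateDerivation_C]
      ring⟩)
  exact hl (by simpa [← hr, coeff_C] using h1.symm)

end Necessity

/-! ### Invariant curves of a non-simple derivation -/

section Darboux

open Polynomial Polynomial.Bivariate

variable {K : Type*} [Field K] {a₀ a₁ a₂ : K[X]}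

theorem coeff_X_mul_derivative {A : Type*} [CommRing A] (f : A[X]) (i : ℕ) :
    (X * derivative f).coeff i = i * f.coeff i := by
  cases i with
  | zero => simp
  | succ i => rw [coeff_X_mul, coeff_derivative, mul_comm]; push_cast; rfl

theorem coeff_zero_bivariateDerivation (f : K[X][Y]) :
    (bivariateDerivation a₀ a₁ a₂ f).coeff 0 = a₀ * f.coeff 1 := by
  simp [bivariateDerivation_apply, mul_coeff_zero, coeff_derivative]

theorem coeff_succ_bivariateDerivation (f : K[X][Y]) (i : ℕ) :
    (bivariateDerivation a₀ a₁ a₂ f).coeff (i + 1) =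
      derivative (f.coeff i) + i * a₂ * f.coeff i + (i + 1) * a₁ * f.coeff (i + 1) +
        (i + 2) * a₀ * f.coeff (i + 2) := by
  have : bivariateDerivation a₀ a₁ a₂ f = X * (coeffDerivative f + C a₂ * (X * derivative f)) +
      C a₁ * (X * derivative f) + C a₀ * derivative f := by
    rw [bivariateDerivation_apply]
    ring
  rw [this, coeff_add, coeff_add, coeff_X_mul, coeff_add, coeff_coeffDerivative, coeff_C_mul,
    coeff_C_mul, coeff_C_mul, coeff_X_mul_derivative, coeff_X_mul_derivative, coeff_derivative]
  push_cast
  ring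

theorem natDegree_bivariateDerivation_le (f : K[X][Y]) :
    (bivariateDerivation a₀ a₁ a₂ f).natDegree ≤ f.natDegree + 1 := by
  refine natDegree_le_iff_coeff_eq_zero.2 fun N hN => ?_
  obtain ⟨i, rfl⟩ : ∃ i, N = i + 1 := ⟨N - 1, by omega⟩
  rw [coeff_succ_bivariateDerivation, coeff_eq_zero_of_natDegree_lt (by omega : f.natDegree < i),
    coeff_eq_zero_of_natDegree_lt (by omega : f.natDegree < i + 1),
    coeff_eq_zero_of_natDegree_lt (by omega : f.natDegree < i + 2)]
  simp

theorem natDegree_cofactor_le {f H : K[X][Y]} (hf : f ≠ 0)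
    (h : bivariateDerivation a₀ a₁ a₂ f = f * H) : H.natDegree ≤ 1 := by
  by_cases hH : H = 0
  · simp [hH]
  · have := natDegree_bivariateDerivation_le (a₀ := a₀) (a₁ := a₁) (a₂ := a₂) f
    rw [h, natDegree_mul hf hH] at this
    omega

/-- The coefficient of `y ^ (n + 1)` in `D f = f H`, where `n` is the degree of `f` in `y`. -/
theorem leadingCoeff_cofactor {f H : K[X][Y]} (hf : f ≠ 0)
    (h : bivariateDerivation a₀ a₁ a₂ f = f * H) :
    derivative f.leadingCoeff + f.natDegree * a₂ * f.leadingCoeff =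
      f.leadingCoeff * H.coeff 1 := by
  have := congrArg (fun g => coeff g (f.natDegree + 1)) h
  simp only [coeff_succ_bivariateDerivation] at this
  rw [coeff_mul_add_eq_of_natDegree_le le_rfl (natDegree_cofactor_le hf h),
    coeff_eq_zero_of_natDegree_lt (by omega : f.natDegree < f.natDegree + 1),
    coeff_eq_zero_of_natDegree_lt (by omega : f.natDegree < f.natDegree + 2)] at this
  simpa using this

/-- For `f` monic in `y` the slope of the cofactor is `n a₂`. -/
theorem exists_cofactor {f : K[X][Y]} (hf : f.Monic)
    (h : f ∣ bivariateDerivation a₀ a₁ a₂ f) :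
    ∃ k : K[X], bivariateDerivation a₀ a₁ a₂ f = f * (C (f.natDegree * a₂) * X + C k) := by
  obtain ⟨H, hH⟩ := h
  have h1 := leadingCoeff_cofactor hf.ne_zero hH
  rw [hf.leadingCoeff, derivative_one, mul_one, one_mul, zero_add] at h1
  refine ⟨H.coeff 0, ?_⟩
  rw [h1, ← eq_X_add_C_of_natDegree_le_one (natDegree_cofactor_le hf.ne_zero hH), hH]

/-- The coefficient of `y⁰` in the equation `D f = (n a₂ y + k) f`. -/
theorem coeff_one_of_cofactor {f : K[X][Y]} {k : K[X]} {n : ℕ}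
    (h : bivariateDerivation a₀ a₁ a₂ f = f * (C (n * a₂) * X + C k)) :
    a₀ * f.coeff 1 = k * f.coeff 0 := by
  have := congrArg (fun g => coeff g 0) h
  simpa [coeff_zero_bivariateDerivation, mul_coeff_zero, mul_comm] using this

/-- The coefficient of `y ^ (i + 1)` in the equation `D f = (n a₂ y + k) f`. -/
theorem coeff_add_two_of_cofactor {f : K[X][Y]} {k : K[X]} {n : ℕ}
    (h : bivariateDerivation a₀ a₁ a₂ f = f * (C (n * a₂) * X + C k)) (i : ℕ) :
    (i + 2) * a₀ * f.coeff (i + 2) =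
      (k - (i + 1) * a₁) * f.coeff (i + 1) + (n - i) * a₂ * f.coeff i -
        derivative (f.coeff i) := by
  have h1 := congrArg (fun g => coeff g (i + 1)) h
  have h2 : f * (C (n * a₂) * X + C k) = C (n * a₂) * (X * f) + C k * f := by ring
  simp only [coeff_succ_bivariateDerivation, h2, coeff_add, coeff_C_mul, coeff_X_mul] at h1
  linear_combination h1

/-- A stable prime ideal meets `K[x]` trivially, so if it is nonzero it contains an irreducible
polynomial of positive degree in `y`. That polynomial divides its image under `D`, since
otherwise the two would be coprime over `K(x)` and a combination of them would be a nonzero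
element of `K[x]`. -/
theorem exists_monic_irreducible_dvd [CharZero K] {c : K} (hc : c ≠ 0) {P : Ideal K[X][Y]}
    (hP : P.IsPrime) (hP0 : P ≠ ⊥) (hs : IsStableIdeal (bivariateDerivation (C c) a₁ a₂) P) :
    ∃ f : K[X][Y], f.Monic ∧ Irreducible f ∧ f ∣ bivariateDerivation (C c) a₁ a₂ f := by
  have hX : (X : K[X][Y]) ∉ P := by
    intro hX
    have h := hs _ hX
    rw [bivariateDerivation_X, pow_two, ← mul_assoc] at h
    have hcP := (P.add_mem_iff_right (add_mem (Ideal.mul_mem_left _ _ hX)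
      (Ideal.mul_mem_left _ _ hX))).1 h
    exact hP.ne_top (P.eq_top_of_isUnit_mem hcP ((hc.isUnit.map C).map C))
  -- A prime `p(x)` in `P` would give `p' y = D p ∈ P`, so `p' ∈ P`, although `p` is separable.
  have hC : P.comap (C : K[X] →+* K[X][Y]) = ⊥ := by
    by_contra hne
    have hp := hP.comap (C : K[X] →+* K[X][Y])
    obtain ⟨p, hpP, hp⟩ := Ideal.IsPrime.exists_mem_prime_of_ne_bot ‹_› hne
    have hp' := hs _ hpP
    rw [bivariateDerivation_C] at hp'
    have hp' := (hP.mem_or_mem hp').resolve_right hX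
    obtain ⟨u, v, huv⟩ := hp.irreducible.separable
    refine hP.ne_top (P.eq_top_iff_one.2 ?_)
    rw [← C_1, ← huv, C_add, C_mul, C_mul]
    exact add_mem (Ideal.mul_mem_left _ _ hpP) (Ideal.mul_mem_left _ _ hp')
  have hC (p : K[X]) (hp : C p ∈ P) : p = 0 := by
    rw [← Ideal.mem_bot, ← hC]
    exact hp
  obtain ⟨f, hfP, hf⟩ := Ideal.IsPrime.exists_mem_prime_of_ne_bot hP hP0
  have hdeg : f.natDegree ≠ 0 := by
    intro h0
    rw [eq_C_of_natDegree_eq_zero h0] at hfP hf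
    exact hf.ne_zero (by rw [hC _ hfP, C_0])
  have hprim := hf.irreducible.isPrimitive hdeg
  have hdvd : f ∣ bivariateDerivation (C c) a₁ a₂ f := by
    by_contra hnd
    set g := bivariateDerivation (C c) a₁ a₂ f
    have hirr := (hprim.irreducible_iff_irreducible_map_fraction_map
      (K := FractionRing K[X])).1 hf.irreducible
    obtain ⟨u, v, huv⟩ := (hirr.coprime_iff_not_dvd (n := g.map (algebraMap _ _))).2
      fun h => hnd (hprim.dvd_of_fraction_map_dvd_fraction_map (K := FractionRing K[X]) h)
    -- Clear denominators in a Bézout relation over `K(x)`.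
    obtain ⟨b, hb0, hb⟩ :=
      IsLocalization.integerNormalization_spec (nonZeroDivisors K[X]) u
    obtain ⟨d, hd0, hd⟩ :=
      IsLocalization.integerNormalization_spec (nonZeroDivisors K[X]) v
    set u' := IsLocalization.integerNormalization (nonZeroDivisors K[X]) u
    set v' := IsLocalization.integerNormalization (nonZeroDivisors K[X]) v
    have hbd : C d * u' * f + C b * v' * g = C (b * d) := by
      apply map_injective _ (IsFractionRing.injective K[X] (FractionRing K[X]))
      simp only [Polynomial.map_add, Polynomial.map_mul, map_C, hb, hd, map_mul, Algebra.smul_def,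
        Polynomial.algebraMap_apply]
      linear_combination C (algebraMap _ (FractionRing K[X]) b) *
        C (algebraMap _ (FractionRing K[X]) d) * huv
    have := hC (b * d) (hbd ▸ add_mem (Ideal.mul_mem_left _ _ hfP)
      (Ideal.mul_mem_left _ _ (hs f hfP)))
    exact (mul_ne_zero (nonZeroDivisors.ne_zero hb0) (nonZeroDivisors.ne_zero hd0)) this
  -- The leading coefficient divides its derivative, so it is a constant.
  obtain ⟨H, hH⟩ := id hdvd
  have hlead : f.leadingCoeff ∣ derivative f.leadingCoeff :=
    (dvd_add_left (Dvd.intro_left _ rfl)).1 (Dvd.intro _ (leadingCoeff_cofactor hf.ne_zero hH).symm)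
  have hlead0 := leadingCoeff_ne_zero.2 hf.ne_zero
  have hd0 := eq_zero_of_dvd_of_degree_lt hlead (degree_derivative_lt hlead0)
  obtain ⟨b, hb⟩ : ∃ b, f.leadingCoeff = C b :=
    ⟨_, eq_C_of_natDegree_eq_zero (derivative_eq_zero.1 hd0)⟩
  have hb0 : b ≠ 0 := fun h => hlead0 (by rw [hb, h, C_0])
  have hu : IsUnit (C (C b⁻¹) : K[X][Y]) := ((inv_ne_zero hb0).isUnit.map C).map C
  refine ⟨C (C b⁻¹) * f, ?_, ?_, ?_⟩
  · rw [Monic, leadingCoeff_mul, leadingCoeff_C, hb, ← C_mul, inv_mul_cancel₀ hb0, C_1]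
  · exact (associated_unit_mul_left f _ hu).irreducible_iff.2 hf.irreducible
  · rw [Derivation.leibniz, bivariateDerivation_C, derivative_C, C_0, zero_mul, smul_zero,
      add_zero, smul_eq_mul]
    exact mul_dvd_mul_left _ hdvd

end Darboux

/-! ### Extending the derivation to algebraic functions -/

section AlgebraicFunctions

open Polynomial

/-- Derivations extend along formally étale algebras, because `Ω[T⁄R]` is the base change of
`Ω[S⁄R]`. -/
theorem Derivation.exists_extend_of_formallyEtale {R S T : Type*} [CommRing R] [CommRing S]
    [CommRing T] [Algebra R S] [Algebra R T] [Algebra S T] [IsScalarTower R S T]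
    [Algebra.FormallyEtale S T] (d : Derivation R S S) :
    ∃ δ : Derivation R T T, ∀ s, δ (algebraMap S T s) = algebraMap S T (d s) := by
  let φ : TensorProduct S T (Ω[S⁄R]) →ₗ[T] T :=
    ((Algebra.linearMap S T).comp d.liftKaehlerDifferential).liftBaseChange T
  let e := KaehlerDifferential.tensorKaehlerEquivOfFormallyEtale R S T
  refine ⟨(φ.comp e.symm.toLinearMap).compDer (KaehlerDifferential.D R T), fun s => ?_⟩
  change φ ((KaehlerDifferential.tensorKaehlerEquivOfFormallyEtale R S T).symm
    (KaehlerDifferential.D R T (algebraMap S T s))) = _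
  rw [KaehlerDifferential.tensorKaehlerEquivOfFormallyEtale_symm_D_algebraMap]
  simp [φ]

/-- Every derivation of a ring into itself defines a differential ring. -/
@[reducible]
def Derivation.toDifferential {R S : Type*} [CommRing R] [CommRing S] [Algebra R S]
    (δ : Derivation R S S) : Differential S :=
  ⟨Derivation.mk' δ.toLinearMap.toAddMonoidHom.toIntLinearMap fun a b => δ.leibniz a b⟩

variable {K : Type*} [Field K]

open scoped Differential

/-- The chain rule for `p(x, z)`. -/
theorem deriv_aeval_eq_coeffDerivative {L : Type*} [CommRing L] [Differential L] [Algebra K[X] L]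
    (hL : ∀ a : K[X], (algebraMap K[X] L a)′ = algebraMap K[X] L (derivative a))
    (z : L) (p : K[X][X]) :
    (aeval z p)′ = aeval z (coeffDerivative p) + aeval z (derivative p) * z′ := by
  induction p using Polynomial.induction_on' with
  | add p q hp hq => simp only [map_add, hp, hq]; ring
  | monomial n a =>
    have : coeffDerivative (monomial n a : K[X][X]) = monomial n (derivative a) := by
      ext i : 1
      simp only [coeff_coeffDerivative, coeff_monomial]
      split_ifs <;> simp
    rw [this, derivative_monomial]
    simp only [aeval_monomial, Derivation.leibniz, Derivation.leibniz_pow, hL, smul_eq_mul,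
      nsmul_eq_mul, map_mul, map_natCast]
    ring

/-- If the logarithmic derivative of a nonzero algebraic function is a polynomial `P`, then `P = 0`.
Differentiating an equation of minimal degree `n` with leading coefficient `e` and constant
coefficient `b` gives `n P e b = e b' - e' b`, and the right side has smaller degree than `e b`. -/
theorem eq_zero_of_deriv_eq_mul [CharZero K] {L : Type*} [Field L] [Differential L]
    [Algebra K[X] L] [FaithfulSMul K[X] L]
    (hL : ∀ a : K[X], (algebraMap K[X] L a)′ = algebraMap K[X] L (derivative a))
    {z : L} (hz : z ≠ 0) {P : K[X]} (hP : z′ = algebraMap K[X] L P * z)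
    (halg : IsAlgebraic K[X] z) : P = 0 := by
  obtain ⟨p, hp0, hp⟩ := halg
  induction hn : p.natDegree using Nat.strong_induction_on generalizing p with
  | _ n ih =>
  subst hn
  by_cases h0 : p.coeff 0 = 0
  · -- The equation is divisible by its variable.
    obtain ⟨q, rfl⟩ := X_dvd_iff.2 h0
    have hq0 : q ≠ 0 := right_ne_zero_of_mul hp0
    refine ih q.natDegree ?_ q hq0 ?_ rfl
    · rw [natDegree_X_mul hq0]
      exact Nat.lt_succ_self _
    · simpa [hz] using hp
  set q : K[X][X] := coeffDerivative p + C P * (X * derivative p) with hq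
  have hqz : aeval z q = 0 := by
    have := deriv_aeval_eq_coeffDerivative hL z p
    rw [hp, map_zero, hP] at this
    rw [hq]
    simp only [map_add, map_mul, aeval_C, aeval_X]
    linear_combination -this
  have hqc (i : ℕ) : q.coeff i = derivative (p.coeff i) + i * P * p.coeff i := by
    rw [hq, coeff_add, coeff_C_mul, coeff_X_mul_derivative, coeff_coeffDerivative]
    ring
  -- The remainder of `q` modulo the equation vanishes by minimality.
  set r : K[X][X] := C p.leadingCoeff * q - C (q.coeff p.natDegree) * p with hr
  have hrz : aeval z r = 0 := by simp [hr, hqz, hp]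
  have hrc (i : ℕ) : r.coeff i = p.leadingCoeff * q.coeff i - q.coeff p.natDegree * p.coeff i := by
    simp [hr]
  have hpd : p.natDegree ≠ 0 := by
    intro h
    rw [eq_C_of_natDegree_eq_zero h, aeval_C] at hp
    exact h0 ((FaithfulSMul.algebraMap_eq_zero_iff K[X] L).1 hp)
  by_cases hr0 : r = 0
  · have h := hrc 0
    rw [hr0, coeff_zero, hqc, hqc, coeff_natDegree] at h
    have hlead := leadingCoeff_ne_zero.2 hp0
    by_contra hP0
    have hprod : p.leadingCoeff * p.coeff 0 ≠ 0 := mul_ne_zero hlead h0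
    have hkey : C (p.natDegree : K) * P * (p.leadingCoeff * p.coeff 0) =
        p.leadingCoeff * derivative (p.coeff 0) - derivative p.leadingCoeff * p.coeff 0 := by
      simp only [Nat.cast_zero, zero_mul, add_zero] at h
      rw [C_eq_natCast]
      linear_combination h
    have hlt : (p.leadingCoeff * derivative (p.coeff 0) -
        derivative p.leadingCoeff * p.coeff 0).degree < (p.leadingCoeff * p.coeff 0).degree := by
      refine (degree_sub_le _ _).trans_lt (max_lt ?_ ?_)
      · rw [degree_mul, degree_mul]
        exact WithBot.add_lt_add_left (degree_ne_bot.2 hlead) (degree_derivative_lt h0)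
      · rw [degree_mul, degree_mul]
        exact WithBot.add_lt_add_right (degree_ne_bot.2 h0) (degree_derivative_lt hlead)
    rw [← hkey] at hlt
    refine absurd (degree_le_mul_left _ ?_) (not_le_of_gt (by rwa [mul_comm] at hlt))
    exact mul_ne_zero (C_ne_zero.2 (Nat.cast_ne_zero.2 hpd)) hP0
  · refine ih r.natDegree ?_ r hr0 hrz rfl
    refine (natDegree_lt_iff_degree_lt hr0).2 ((degree_lt_iff_coeff_zero _ _).2 fun m hm => ?_)
    rw [hrc]
    rcases hm.eq_or_lt with rfl | hm
    · rw [coeff_natDegree]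
      ring
    · rw [hqc, coeff_eq_zero_of_natDegree_lt hm]
      simp

open Differential in
/-- Let `y` run over `n` distinct solutions of `y y' = a₂ y² + a₁ y + c` with trace `T` satisfying
`T' = a₂ T + n a₁ - k`. The logarithmic derivatives of `yᵢ - yⱼ` and `yᵢ` are
`a₂ - c / (yᵢ yⱼ)` and `a₂ + a₁ / yᵢ + c / yᵢ²`, so that of the discriminant divided by the norm
involves the `yᵢ` only through `∑ 1 / yᵢ = - k / c`. -/
theorem logDeriv_discr_div_norm {L : Type*} [Field L] [Differential L] {s : Finset L}
    {a₁ a₂ c k : L} (hs : ∀ y ∈ s, y ≠ 0)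
    (hy : ∀ y ∈ s, y * y′ = a₂ * y ^ 2 + a₁ * y + c)
    (hT : (∑ y ∈ s, y)′ = a₂ * ∑ y ∈ s, y + s.card * a₁ - k) :
    c * logDeriv ((∏ p ∈ s.offDiag, (p.1 - p.2)) / ∏ y ∈ s, y) =
      c * (s.card * (s.card - 2) * a₂) - k * (k - a₁) := by
  classical
  have hy' : ∀ y ∈ s, y′ = a₂ * y + a₁ + c * y⁻¹ := fun y h => by
    have h0 := hs y h
    field_simp
    linear_combination hy y h
  have hS : c * ∑ y ∈ s, y⁻¹ = -k := by
    rw [map_sum, Finset.sum_congr rfl hy', Finset.sum_add_distrib, Finset.sum_add_distrib,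
      ← Finset.mul_sum, ← Finset.mul_sum, Finset.sum_const, nsmul_eq_mul] at hT
    linear_combination hT
  have hlog : ∀ y ∈ s, logDeriv y = a₂ + a₁ * y⁻¹ + c * (y⁻¹ * y⁻¹) := fun y h => by
    have h0 := hs y h
    rw [Differential.logDeriv, hy' y h]
    field_simp
  have hoff : ∀ p ∈ s.offDiag, p.1 - p.2 ≠ 0 := fun p hp =>
    sub_ne_zero.2 (Finset.mem_offDiag.1 hp).2.2
  have hlog' : ∀ p ∈ s.offDiag, logDeriv (p.1 - p.2) = a₂ - c * (p.1⁻¹ * p.2⁻¹) :=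
    fun p hp => by
      obtain ⟨h1, h2, -⟩ := Finset.mem_offDiag.1 hp
      have h1' := hs _ h1
      have h2' := hs _ h2
      have h3 := hoff p hp
      rw [Differential.logDeriv, map_sub, hy' _ h1, hy' _ h2]
      field_simp
      ring
  have hsq : (∑ y ∈ s, y⁻¹) * ∑ y ∈ s, y⁻¹ =
      ∑ y ∈ s, y⁻¹ * y⁻¹ + ∑ p ∈ s.offDiag, p.1⁻¹ * p.2⁻¹ := by
    rw [Finset.sum_mul_sum, ← Finset.sum_product', ← Finset.diag_union_offDiag,
      Finset.sum_union (Finset.disjoint_diag_offDiag s), Finset.sum_diag]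
  have hcard : (s.offDiag.card : L) = s.card * s.card - s.card := by
    rw [Finset.offDiag_card, Nat.cast_sub (Nat.le_mul_self _), Nat.cast_mul]
  rw [logDeriv_div _ _ (Finset.prod_ne_zero_iff.2 hoff) (Finset.prod_ne_zero_iff.2 hs),
    logDeriv_prod _ _ _ hoff, logDeriv_prod _ _ _ hs, Finset.sum_congr rfl hlog,
    Finset.sum_congr rfl hlog', Finset.sum_sub_distrib, Finset.sum_add_distrib,
    Finset.sum_add_distrib, ← Finset.mul_sum, ← Finset.mul_sum, ← Finset.mul_sum,
    Finset.sum_const, Finset.sum_const, nsmul_eq_mul, nsmul_eq_mul, hcard]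
  linear_combination c ^ 2 * hsq - (c * ∑ y ∈ s, y⁻¹ - k + a₁) * hS

/-- The derivation `d/dx` extends to an algebraic closure of `K(x)`. -/
theorem exists_differential_algebraicClosure [CharZero K] :
    ∃ _ : Differential (AlgebraicClosure (FractionRing K[X])), ∀ a : K[X],
      (algebraMap K[X] (AlgebraicClosure (FractionRing K[X])) a)′ =
        algebraMap K[X] (AlgebraicClosure (FractionRing K[X])) (derivative a) := by
  have : Algebra.FormallyEtale K[X] (FractionRing K[X]) := .of_isLocalization (nonZeroDivisors K[X])
  have : CharZero (FractionRing K[X]) :=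
    charZero_of_injective_algebraMap (IsFractionRing.injective K[X] (FractionRing K[X]))
  have : Algebra.FormallyEtale (FractionRing K[X]) (AlgebraicClosure (FractionRing K[X])) :=
    .of_isSeparable _ _
  have : Algebra.FormallyEtale K[X] (AlgebraicClosure (FractionRing K[X])) :=
    .comp K[X] (FractionRing K[X]) _
  obtain ⟨δ, hδ⟩ := (derivative' (R := K)).exists_extend_of_formallyEtale
    (T := AlgebraicClosure (FractionRing K[X]))
  exact ⟨δ.toDifferential, hδ⟩

section

open Polynomial.Bivariate

variable {L : Type*} [Field L] [Differential L] [Algebra K[X] L]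

/-- A simple zero `y` of an invariant curve satisfies `y y' = a₂ y² + a₁ y + c`. -/
theorem mul_deriv_eq_of_dvd
    (hL : ∀ a : K[X], (algebraMap K[X] L a)′ = algebraMap K[X] L (derivative a))
    {a₀ a₁ a₂ : K[X]} {f : K[X][Y]} (h : f ∣ bivariateDerivation a₀ a₁ a₂ f) {y : L}
    (hy : aeval y f = 0) (hy' : aeval y (derivative f) ≠ 0) :
    y * y′ = algebraMap K[X] L a₂ * y ^ 2 + algebraMap K[X] L a₁ * y + algebraMap K[X] L a₀ := by
  have h1 := deriv_aeval_eq_coeffDerivative hL y f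
  rw [hy, map_zero] at h1
  obtain ⟨H, hH⟩ := h
  have h2 := congrArg (aeval y) hH
  rw [bivariateDerivation_apply] at h2
  simp only [map_add, map_mul, map_pow, aeval_X, aeval_C, hy, zero_mul] at h2
  refine mul_left_cancel₀ hy' ?_
  linear_combination -y * h1 - h2

/-- The key identity: at an irreducible invariant curve, the polynomial
`n (n - 2) a₂ - k (k - a₁) / c` is the logarithmic derivative of an algebraic function, hence
zero. -/
theorem cofactor_identity [CharZero K] {c : K} (hc : c ≠ 0) {a₁ a₂ k : K[X]} {f : K[X][Y]}
    (hf : f.Monic) (hirr : Irreducible f)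
    (h : bivariateDerivation (C c) a₁ a₂ f = f * (C (f.natDegree * a₂) * X + C k)) :
    C c * (f.natDegree * (f.natDegree - 2) * a₂) = k * (k - a₁) := by
  obtain ⟨_, hL⟩ := exists_differential_algebraicClosure (K := K)
  set L := AlgebraicClosure (FractionRing K[X])
  have : CharZero (FractionRing K[X]) :=
    charZero_of_injective_algebraMap (IsFractionRing.injective K[X] (FractionRing K[X]))
  have hinj : Function.Injective (algebraMap K[X] L) := by
    rw [IsScalarTower.algebraMap_eq K[X] (FractionRing K[X]) L]
    exact (algebraMap (FractionRing K[X]) L).injective.comp (IsFractionRing.injective _ _)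
  have : FaithfulSMul K[X] L := (faithfulSMul_iff_algebraMap_injective _ _).2 hinj
  have hc' : algebraMap K[X] L (C c) ≠ 0 := fun h0 =>
    hc (C_eq_zero.1 (hinj (h0.trans (map_zero _).symm)))
  have hsep : (f.map (algebraMap K[X] L)).Separable := by
    rw [IsScalarTower.algebraMap_eq K[X] (FractionRing K[X]) L, ← Polynomial.map_map]
    exact ((hf.irreducible_iff_irreducible_map_fraction_map
      (K := FractionRing K[X])).1 hirr).separable.map
  have hmonic := hf.map (algebraMap K[X] L)
  have hsplit := IsAlgClosed.splits (f.map (algebraMap K[X] L))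
  set s : Finset L := ⟨(f.map (algebraMap K[X] L)).roots, nodup_roots hsep⟩ with hs
  have hcard : s.card = f.natDegree := by
    rw [← hf.natDegree_map (algebraMap K[X] L), hsplit.natDegree_eq_card_roots]
    rfl
  have hn : f.natDegree ≠ 0 := fun h0 =>
    hirr.not_isUnit (hf.natDegree_eq_zero.1 h0 ▸ isUnit_one)
  have hsum : ∑ y ∈ s, y = -algebraMap K[X] L (f.coeff (f.natDegree - 1)) := by
    rw [← nextCoeff_of_natDegree_pos (Nat.pos_of_ne_zero hn), ← nextCoeff_map hinj,
      hsplit.nextCoeff_eq_neg_sum_roots_of_monic hmonic, neg_neg]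
    simp [Finset.sum, hs]
  have hroot : ∀ y ∈ s, aeval y f = 0 := fun y hy => by
    have := isRoot_of_mem_roots (p := f.map (algebraMap K[X] L)) hy
    rwa [IsRoot, eval_map_algebraMap] at this
  have hroot' : ∀ y ∈ s, aeval y (derivative f) ≠ 0 := fun y hy => by
    have := Separable.eval₂_derivative_ne_zero (RingHom.id L) hsep (x := y)
      (by rw [eval₂_id, eval_map_algebraMap, hroot y hy])
    rwa [eval₂_id, derivative_map, eval_map_algebraMap] at this
  have hy : ∀ y ∈ s, _ := fun y hy =>
    mul_deriv_eq_of_dvd hL (Dvd.intro _ h.symm) (hroot y hy) (hroot' y hy)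
  have hy0 : ∀ y ∈ s, y ≠ 0 := by
    rintro y hys rfl
    exact hc' (by simpa using (hy 0 hys).symm)
  -- The coefficient of `yⁿ` in `D f = (n a₂ y + k) f`.
  have htrace : derivative (f.coeff (f.natDegree - 1)) =
      a₂ * f.coeff (f.natDegree - 1) + k - f.natDegree * a₁ := by
    have h1 := congrArg (fun g => coeff g (f.natDegree - 1 + 1)) h
    have h2 : f * (C (f.natDegree * a₂) * X + C k) =
      C (f.natDegree * a₂) * (X * f) + C k * f := by ring
    simp only [coeff_succ_bivariateDerivation, h2, coeff_add, coeff_C_mul, coeff_X_mul] at h1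
    have h3 : f.natDegree - 1 + 1 = f.natDegree := by omega
    have h4 : f.natDegree - 1 + 2 = f.natDegree + 1 := by omega
    rw [h3, h4, hf.coeff_natDegree, coeff_eq_zero_of_natDegree_lt (Nat.lt_succ_self _)] at h1
    have h5 : ((f.natDegree - 1 : ℕ) : K[X]) = f.natDegree - 1 := by
      rw [Nat.cast_sub (by omega), Nat.cast_one]
    rw [h5] at h1
    linear_combination h1
  have hT : (∑ y ∈ s, y)′ = algebraMap K[X] L a₂ * ∑ y ∈ s, y +
      s.card * algebraMap K[X] L a₁ - algebraMap K[X] L k := by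
    rw [hsum, map_neg, hL, htrace, hcard]
    simp only [map_sub, map_add, map_mul, map_natCast]
    ring
  have hlog := logDeriv_discr_div_norm hy0 hy hT
  set w := (∏ p ∈ s.offDiag, (p.1 - p.2)) / ∏ y ∈ s, y with hw
  have hw0 : w ≠ 0 := div_ne_zero
    (Finset.prod_ne_zero_iff.2 fun p hp => sub_ne_zero.2 (Finset.mem_offDiag.1 hp).2.2)
    (Finset.prod_ne_zero_iff.2 hy0)
  have hcc : C c⁻¹ * C c = (1 : K[X]) := by rw [← C_mul, inv_mul_cancel₀ hc, C_1]
  have hcL := congrArg (algebraMap K[X] L) hcc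
  rw [map_mul, map_one] at hcL
  have hP := eq_zero_of_deriv_eq_mul hL hw0
    (P := f.natDegree * (f.natDegree - 2) * a₂ - C c⁻¹ * (k * (k - a₁))) (by
      rw [← div_eq_iff hw0, ← Differential.logDeriv]
      simp only [map_sub, map_mul, map_natCast, map_ofNat]
      rw [hcard] at hlog
      linear_combination algebraMap K[X] L (C c⁻¹) * hlog - (Differential.logDeriv w -
        f.natDegree * (f.natDegree - 2) * algebraMap K[X] L a₂) * hcL)
    ((IsFractionRing.isAlgebraic_iff K[X] (FractionRing K[X]) L).2
      (Algebra.IsAlgebraic.isAlgebraic w))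
  linear_combination C c * hP + (k * (k - a₁)) * hcc

end

end AlgebraicFunctions

/-! ### The coefficients of an invariant curve -/

section Recurrence

open Polynomial

variable {K : Type*} [Field K]

/-- The coefficients `g i` of a monic Darboux polynomial of degree `n` in `y`, with cofactor
`n a₂ y + k`, of the derivation `y ∂_x + (a₂ y² + a₁ y + c) ∂_y`, together with the identity that
the irreducibility of the polynomial forces on its cofactor. -/
structure InvariantCoeffs (c : K) (a₁ a₂ k : K[X]) (n : ℕ) (g : ℕ → K[X]) : Prop where
  ne_zero : c ≠ 0
  zero : C c * g 1 = k * g 0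
  succ (i : ℕ) : (i + 2) * C c * g (i + 2) =
    (k - (i + 1) * a₁) * g (i + 1) + (n - i) * a₂ * g i - derivative (g i)
  top : g n = 1
  eq_zero_of_lt (i : ℕ) : n < i → g i = 0
  identity : C c * (n * (n - 2) * a₂) = k * (k - a₁)

namespace InvariantCoeffs

variable {c : K} {a₁ a₂ k : K[X]} {n : ℕ} {g : ℕ → K[X]}

theorem C_ne_zero (H : InvariantCoeffs c a₁ a₂ k n g) : (C c : K[X]) ≠ 0 :=
  Polynomial.C_ne_zero.2 H.ne_zero

theorem natCast_add_two_ne_zero [CharZero K] (i : ℕ) : (i : K[X]) + 2 ≠ 0 := by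
  have : ((i + 2 : ℕ) : K[X]) ≠ 0 := Nat.cast_ne_zero.2 (by omega)
  push_cast at this
  exact this

/-- If `g 0` vanished, so would all coefficients by the recurrence. -/
theorem coeff_zero_ne_zero [CharZero K] (H : InvariantCoeffs c a₁ a₂ k n g) : g 0 ≠ 0 := by
  intro h0
  have key (i : ℕ) : g i = 0 ∧ g (i + 1) = 0 := by
    induction i with
    | zero => exact ⟨h0, by simpa [h0, H.ne_zero] using H.zero⟩
    | succ i ih =>
      refine ⟨ih.2, ?_⟩
      have h := H.succ i
      rw [ih.1, ih.2, derivative_zero, mul_zero, mul_zero, add_zero, sub_zero] at h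
      exact (mul_eq_zero.1 h).resolve_left
        (mul_ne_zero (natCast_add_two_ne_zero i) H.C_ne_zero)
  exact one_ne_zero (H.top.symm.trans (key n).1)

/-- Invariant curves of degree one in `y` are the lines `1 + l y = 0`. -/
theorem exists_of_eq_one (H : InvariantCoeffs c a₁ a₂ k 1 g) :
    ∃ l : K, l ≠ 0 ∧ a₂ = C l * a₁ - C (l ^ 2) * C c := by
  have h0 := H.zero
  rw [H.top, mul_one] at h0
  have hu : IsUnit k := isUnit_of_mul_isUnit_left (h0 ▸ H.ne_zero.isUnit.map C)
  obtain ⟨b, hb, rfl⟩ := Polynomial.isUnit_iff.1 hu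
  have hcc : C c * C c⁻¹ = (1 : K[X]) := by rw [← C_mul, mul_inv_cancel₀ H.ne_zero, C_1]
  refine ⟨b * c⁻¹, mul_ne_zero hb.ne_zero (inv_ne_zero H.ne_zero), ?_⟩
  have h := H.identity
  refine mul_left_cancel₀ H.C_ne_zero ?_
  push_cast at h
  simp only [C_mul, C_pow]
  linear_combination -h - C b * (a₁ - C b * (C c * C c⁻¹ + 1)) * hcc

/-- The identity on the cofactor turns the equation for the coefficient of `y` into a relation
between `g 0` and `g 2` only. -/
theorem derivative_coeff_zero (H : InvariantCoeffs c a₁ a₂ k n g) :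
    derivative (g 0) + 2 * C c * g 2 = n * (n - 1) * a₂ * g 0 := by
  have h := H.succ 0
  refine mul_left_cancel₀ H.C_ne_zero ?_
  push_cast at h
  linear_combination C c * h + (k - a₁) * H.zero - g 0 * H.identity

section LinearCase

/-- For `a₂ = 0` the recurrence read downwards determines `(g i)'` from `g (i + 1)` and
`g (i + 2)`, so the degree grows by at most `deg a₁ + 1` in each step. -/
theorem natDegree_le_of_eq_zero [CharZero K] (H : InvariantCoeffs c a₁ 0 k n g)
    (hk : k.natDegree ≤ a₁.natDegree) (j i : ℕ) (hij : n ≤ i + j) :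
    (g i).natDegree ≤ j * (a₁.natDegree + 1) := by
  induction j generalizing i with
  | zero =>
    rcases hij.eq_or_lt with h | h
    · rw [add_zero] at h
      rw [← h, H.top]
      simp
    · rw [H.eq_zero_of_lt i h]
      simp
  | succ j ih =>
    have h : derivative (g i) =
        (k - ((i + 1 : ℕ) : K[X]) * a₁) * g (i + 1) - (i + 2 : ℕ) * C c * g (i + 2) := by
      have := H.succ i
      push_cast
      linear_combination this
    have hd : (derivative (g i)).natDegree ≤ a₁.natDegree + j * (a₁.natDegree + 1) := by
      rw [h]
      refine (natDegree_sub_le_of_le (natDegree_mul_le_of_le (natDegree_sub_le_of_le hk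
        (n := a₁.natDegree) ?_) (ih _ (by omega)))
        (n := a₁.natDegree + j * (a₁.natDegree + 1)) ?_).trans (by simp)
      · rw [← C_eq_natCast]
        exact natDegree_C_mul_le _ _
      · rw [← C_eq_natCast, ← C_mul]
        exact (natDegree_C_mul_le _ _).trans ((ih _ (by omega)).trans (Nat.le_add_left _ _))
    rw [natDegree_derivative] at hd
    have : (j + 1) * (a₁.natDegree + 1) = a₁.natDegree + j * (a₁.natDegree + 1) + 1 := by ring
    omega

/-- For `a₂ = 0` and `k = κ a₁` the bound on the degree of `g i` is attained for `i ≥ κ`, since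
passing from `g (i + 1)` to `g i` multiplies the leading coefficients by a nonzero multiple of
`κ - (i + 1)`. -/
theorem coeff_ne_zero_of_eq_zero [CharZero K] {κ : ℕ} (hd : a₁.natDegree ≠ 0)
    (H : InvariantCoeffs c a₁ 0 (κ * a₁) n g) (j i : ℕ) (hij : i + j = n) (hi : κ ≤ i) :
    (g i).coeff (j * (a₁.natDegree + 1)) ≠ 0 := by
  have hk : ((κ : K[X]) * a₁).natDegree ≤ a₁.natDegree := by
    rw [← C_eq_natCast]
    exact natDegree_C_mul_le _ _
  induction j generalizing i with
  | zero =>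
    rw [add_zero] at hij
    rw [hij, H.top]
    simp
  | succ j ih =>
    have h : derivative (g i) =
        C ((κ : K) - (i + 1 : ℕ)) * (a₁ * g (i + 1)) - C ((i + 2 : ℕ) * c) * g (i + 2) := by
      have := H.succ i
      simp only [C_sub, C_mul, C_eq_natCast]
      push_cast
      linear_combination this
    have h' := congrArg (fun p => coeff p (a₁.natDegree + j * (a₁.natDegree + 1))) h
    simp only [coeff_derivative, coeff_sub, coeff_C_mul] at h'
    rw [coeff_mul_add_eq_of_natDegree_le le_rfl (H.natDegree_le_of_eq_zero hk _ _ (by omega)),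
      coeff_eq_zero_of_natDegree_lt
        ((H.natDegree_le_of_eq_zero hk j (i + 2) (by omega)).trans_lt (by omega)),
      mul_zero, sub_zero] at h'
    rw [(by ring : (j + 1) * (a₁.natDegree + 1) = a₁.natDegree + j * (a₁.natDegree + 1) + 1)]
    intro h0
    rw [h0, zero_mul] at h'
    refine mul_ne_zero ?_ (mul_ne_zero ?_ (ih (i + 1) (by omega) (by omega))) h'.symm
    · exact sub_ne_zero.2 (Nat.cast_injective.ne (by omega))
    · exact leadingCoeff_ne_zero.2 fun h => hd (by simp [h])

/-- For `a₂ = 0` the identity leaves `k = 0` and `k = a₁`. In both cases the exact degrees of the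
coefficients contradict the recurrence near `g 0`. -/
theorem false_of_eq_zero [CharZero K] (H : InvariantCoeffs c a₁ 0 k n g)
    (hd : a₁.natDegree ≠ 0) (hn : 2 ≤ n) : False := by
  have h2 := H.derivative_coeff_zero
  rw [mul_zero, zero_mul] at h2
  have hid := H.identity
  rw [mul_zero, mul_zero] at hid
  have hg0 := H.coeff_zero_ne_zero
  have hg0' : derivative (g 0) = C (-(2 * c)) * g 2 := by
    simp only [C_neg, C_mul, C_ofNat]
    linear_combination h2
  obtain ⟨n, rfl⟩ : ∃ m, n = m + 2 := ⟨n - 2, by omega⟩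
  rcases mul_eq_zero.1 hid.symm with rfl | hk
  · -- `g 0` is too large for its derivative to be a multiple of `g 2`.
    have H' : InvariantCoeffs c a₁ 0 ((0 : ℕ) * a₁) (n + 2) g := by simpa using H
    have h0 := le_natDegree_of_ne_zero (H'.coeff_ne_zero_of_eq_zero hd (n + 2) 0 (by omega) le_rfl)
    have h1 := H.natDegree_le_of_eq_zero (by simp) n 2 (by omega)
    have h3 := congrArg natDegree hg0'
    rw [natDegree_derivative] at h3
    have h4 := natDegree_C_mul_le (-(2 * c)) (g 2)
    have : (n + 2) * (a₁.natDegree + 1) = n * (a₁.natDegree + 1) + 2 * (a₁.natDegree + 1) := by ring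
    omega
  · obtain rfl := sub_eq_zero.1 hk
    have H' : InvariantCoeffs c k 0 ((1 : ℕ) * k) (n + 2) g := by simpa using H
    have hk0 : k ≠ 0 := fun h => hd (by simp [h])
    have h0 := le_natDegree_of_ne_zero (H'.coeff_ne_zero_of_eq_zero hd (n + 1) 1 (by omega) le_rfl)
    have h1 : (g 1).natDegree = k.natDegree + (g 0).natDegree := by
      rw [← natDegree_mul hk0 hg0, ← H.zero, natDegree_C_mul H.ne_zero]
    have h3 := H.natDegree_le_of_eq_zero le_rfl n 3 (by omega)
    -- Eliminating `g 1` and `g 2` expresses `g 3` through `g 0`.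
    have h4 : k * derivative (g 0) + 2 * (derivative k * g 0) = C (-(6 * c ^ 2)) * g 3 := by
      have h5 := H.succ 1
      have h6 := congrArg derivative H.zero
      rw [derivative_C_mul, derivative_mul] at h6
      simp only [C_neg, C_mul, C_ofNat, C_pow]
      push_cast at h5
      linear_combination 2 * C c * h5 - 2 * h6 - k * h2
    have hm : (g 0).natDegree ≠ 0 ∧ n * (k.natDegree + 1) < (g 0).natDegree := by
      have : (n + 1) * (k.natDegree + 1) = n * (k.natDegree + 1) + (k.natDegree + 1) := by ring
      constructor <;> omega
    obtain ⟨d, hd'⟩ := Nat.exists_eq_succ_of_ne_zero hd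
    obtain ⟨m, hm'⟩ := Nat.exists_eq_succ_of_ne_zero hm.1
    have h5 := congrArg (fun p => coeff p (d + 1 + m)) h4
    simp only [coeff_add, coeff_C_mul] at h5
    rw [coeff_eq_zero_of_natDegree_lt (h3.trans_lt (by omega)), mul_zero,
      ← C_ofNat, coeff_C_mul,
      coeff_mul_add_eq_of_natDegree_le hd'.le (by rw [natDegree_derivative]; omega),
      (by ring : d + 1 + m = d + (m + 1)),
      coeff_mul_add_eq_of_natDegree_le (by rw [natDegree_derivative]; omega) hm'.le,
      coeff_derivative, coeff_derivative] at h5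
    have h6 : k.coeff (d + 1) ≠ 0 := by
      rw [← Nat.succ_eq_add_one, ← hd']
      exact leadingCoeff_ne_zero.2 hk0
    have h7 : (g 0).coeff (m + 1) ≠ 0 := by
      rw [← Nat.succ_eq_add_one, ← hm']
      exact leadingCoeff_ne_zero.2 hg0
    have h8 : ((m : K) + 1 + 2 * (d + 1)) ≠ 0 := by
      exact_mod_cast (by omega : m + 1 + 2 * (d + 1) ≠ 0)
    refine mul_ne_zero h8 (mul_ne_zero h6 h7) ?_
    linear_combination h5

end LinearCase

/-- For `n = 2` the relation `g 0' + 2 c = 2 a₂ g 0` makes `a₂` and `g 0` constants; then `a₁` is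
not constant, which contradicts the equation for the coefficient of `y²`. -/
theorem false_of_eq_two [CharZero K] (H : InvariantCoeffs c a₁ a₂ k 2 g) (ha₂ : a₂ ≠ 0)
    (hd : a₁.natDegree ≠ 0 ∨ a₂.natDegree ≠ 0) : False := by
  have hg0 := H.coeff_zero_ne_zero
  have h2 : C (2 * c) + derivative (g 0) = C 2 * (a₂ * g 0) := by
    have := H.derivative_coeff_zero
    rw [H.top] at this
    simp only [C_mul, C_ofNat]
    push_cast at this
    linear_combination this
  -- Comparing degrees, `a₂` and `g 0` are constants with product `c`.
  have hdeg : a₂.natDegree + (g 0).natDegree ≤ (g 0).natDegree - 1 := by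
    rw [← natDegree_mul ha₂ hg0, ← natDegree_C_mul (two_ne_zero (α := K)), ← h2]
    refine (natDegree_add_le _ _).trans ?_
    rw [natDegree_C, natDegree_derivative]
    omega
  have hg0' : derivative (g 0) = 0 := derivative_eq_zero.2 (by omega)
  have hprod : a₂ * g 0 = C c := by
    refine mul_left_cancel₀ (Polynomial.C_ne_zero.2 (two_ne_zero (α := K))) ?_
    rw [← h2, hg0', add_zero, C_mul]
  have hd1 : a₁.natDegree ≠ 0 := by omega
  have ha₁ : a₁ ≠ 0 := fun h => hd1 (by simp [h])
  have h3 : k - 2 * a₁ + a₂ * g 1 = derivative (g 1) := by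
    have := H.succ 1
    rw [H.eq_zero_of_lt _ (by omega), H.top] at this
    push_cast at this
    linear_combination -this
  have hid := H.identity
  rw [Nat.cast_ofNat, sub_self, mul_zero, zero_mul, mul_zero] at hid
  have h1 := H.zero
  rcases mul_eq_zero.1 hid.symm with rfl | hk
  · have hg1 : g 1 = 0 := by simpa [H.ne_zero] using h1
    rw [hg1, derivative_zero, mul_zero, add_zero, zero_sub, neg_eq_zero] at h3
    exact ha₁ ((mul_eq_zero.1 h3).resolve_left two_ne_zero)
  · obtain rfl := sub_eq_zero.1 hk
    have h6 := congrArg derivative h1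
    rw [derivative_C_mul, derivative_mul, hg0', mul_zero, add_zero] at h6
    have h7 : derivative k * g 0 = 0 := by
      linear_combination -h6 - C c * h3 + a₂ * h1 + k * hprod
    exact hd1 (derivative_eq_zero.1 ((mul_eq_zero.1 h7).resolve_right hg0))

section QuadraticCase

/-- With `x`, `a₁`, `k` and `a₂` given the weights `1`, `d`, `d` and `2 d`, the recurrence read
upwards raises the degree by at most `d` in each step. -/
theorem natDegree_le [CharZero K] {d : ℕ} (H : InvariantCoeffs c a₁ a₂ k n g)
    (h₁ : a₁.natDegree ≤ d) (hk : k.natDegree ≤ d) (h₂ : a₂.natDegree ≤ d + d) (i : ℕ) :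
    (g i).natDegree ≤ (g 0).natDegree + i * d := by
  have key (i : ℕ) : (g i).natDegree ≤ (g 0).natDegree + i * d ∧
      (g (i + 1)).natDegree ≤ (g 0).natDegree + (i + 1) * d := by
    induction i with
    | zero =>
      refine ⟨by omega, ?_⟩
      rw [← natDegree_C_mul H.ne_zero, H.zero]
      exact natDegree_mul_le.trans (by omega)
    | succ i ih =>
      refine ⟨ih.2, ?_⟩
      have h : C ((i + 2 : ℕ) * c) * g (i + 2) =
          (k - C ((i + 1 : ℕ) : K) * a₁) * g (i + 1) + C ((n : K) - i) * a₂ * g i -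
            derivative (g i) := by
        have := H.succ i
        simp only [C_sub, C_mul, C_eq_natCast]
        push_cast
        linear_combination this
      rw [← natDegree_C_mul
        (mul_ne_zero (Nat.cast_ne_zero.2 (Nat.succ_ne_zero (i + 1))) H.ne_zero), h]
      have e₁ : d + ((g 0).natDegree + (i + 1) * d) = (g 0).natDegree + (i + 1 + 1) * d := by ring
      have e₂ : d + d + ((g 0).natDegree + i * d) = (g 0).natDegree + (i + 1 + 1) * d := by ring
      have l₁ : (k - C ((i + 1 : ℕ) : K) * a₁).natDegree ≤ d :=
        (natDegree_sub_le_of_le hk ((natDegree_C_mul_le _ _).trans h₁)).trans_eq (max_self d)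
      have l₂ : (derivative (g i)).natDegree ≤ (g 0).natDegree + (i + 1 + 1) * d :=
        (natDegree_derivative_le _).trans ((Nat.sub_le _ _).trans (ih.1.trans (by
          gcongr
          omega)))
      refine (natDegree_sub_le_of_le (natDegree_add_le_of_le
        ((natDegree_mul_le_of_le l₁ ih.2).trans_eq e₁)
        ((natDegree_mul_le_of_le ((natDegree_C_mul_le _ _).trans h₂) ih.1).trans_eq e₂))
        l₂).trans (by simp)
  exact (key i).1

/-- The coefficients of highest weight of the `g i` satisfy the recurrence without its derivative
term. As `g n = 1` has smaller weight than allowed, the weight of `a₂` cannot be maximal: otherwise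
the recurrence, read downwards, would kill the leading coefficient of `g 0`. -/
theorem coeff_eq_zero [CharZero K] {d : ℕ} (hd : d ≠ 0) (hn : n ≠ 0)
    (H : InvariantCoeffs c a₁ a₂ k n g) (h₁ : a₁.natDegree ≤ d) (hk : k.natDegree ≤ d)
    (h₂ : a₂.natDegree ≤ d + d) : a₂.coeff (d + d) = 0 := by
  by_contra hβ
  have hdeg := H.natDegree_le h₁ hk h₂
  set m := (g 0).natDegree with hm
  have hrec (i : ℕ) : ((i + 2 : ℕ) * c) * (g (i + 2)).coeff (m + (i + 2) * d) =
      (k.coeff d - (i + 1 : ℕ) * a₁.coeff d) * (g (i + 1)).coeff (m + (i + 1) * d) +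
        ((n : K) - i) * (a₂.coeff (d + d) * (g i).coeff (m + i * d)) := by
    have h : C ((i + 2 : ℕ) * c) * g (i + 2) =
        (k - C ((i + 1 : ℕ) : K) * a₁) * g (i + 1) + C ((n : K) - i) * (a₂ * g i) -
          derivative (g i) := by
      have := H.succ i
      simp only [C_sub, C_mul, C_eq_natCast]
      push_cast
      linear_combination this
    have h' := congrArg (fun p => coeff p (m + (i + 2) * d)) h
    simp only [coeff_sub, coeff_add, coeff_C_mul] at h'
    have hder : (derivative (g i)).coeff (m + (i + 2) * d) = 0 := by
      refine coeff_eq_zero_of_natDegree_lt ((natDegree_derivative_le _).trans_lt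
        ((Nat.sub_le _ _).trans_lt ((hdeg i).trans_lt ?_)))
      gcongr
      omega
    rw [h', hder, sub_zero]
    congr 1
    · rw [(by ring : m + (i + 2) * d = d + (m + (i + 1) * d)),
        coeff_mul_add_eq_of_natDegree_le ((natDegree_sub_le_of_le hk
          ((natDegree_C_mul_le _ _).trans h₁)).trans_eq (max_self d)) (hdeg _), coeff_sub,
        coeff_C_mul]
    · rw [(by ring : m + (i + 2) * d = (d + d) + (m + i * d)),
        coeff_mul_add_eq_of_natDegree_le h₂ (hdeg _)]
  have htop (i : ℕ) (hi : n ≤ i) : (g i).coeff (m + i * d) = 0 := by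
    rcases hi.eq_or_lt with rfl | hi
    · rw [H.top, coeff_one, if_neg]
      have := Nat.mul_ne_zero hn hd
      omega
    · rw [H.eq_zero_of_lt i hi, coeff_zero]
  have hall (j i : ℕ) (hij : n ≤ i + j) : (g i).coeff (m + i * d) = 0 := by
    induction j generalizing i with
    | zero => exact htop i hij
    | succ j ih =>
      by_cases hi : n ≤ i
      · exact htop i hi
      have h := hrec i
      rw [ih (i + 1) (by omega), ih (i + 2) (by omega), mul_zero, mul_zero, zero_add] at h
      have hni : (n : K) - i ≠ 0 := sub_ne_zero.2 (Nat.cast_injective.ne (by omega))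
      exact (mul_eq_zero.1 ((mul_eq_zero.1 h.symm).resolve_left hni)).resolve_left hβ
  have h0 := hall n 0 (by omega)
  rw [zero_mul, add_zero, hm, coeff_natDegree, leadingCoeff_eq_zero] at h0
  exact H.coeff_zero_ne_zero h0

/-- The degree bounds make one of `k` and `k - a₁` constant and the coefficient `g (n - 1)`
constant, and the two resulting linear relations between `a₁` and `a₂` are incompatible. -/
theorem false_of_three_le [CharZero K] (H : InvariantCoeffs c a₁ a₂ k n g) (hn : 3 ≤ n)
    (ha₂ : a₂ ≠ 0) (hdeg : a₁.natDegree ≠ 0 ∨ a₂.natDegree ≠ 0) : False := by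
  obtain ⟨N, hN⟩ : ∃ N : K, N = c * (n * (n - 2)) := ⟨_, rfl⟩
  have hn0 : (n : K) ≠ 0 := Nat.cast_ne_zero.2 (by omega)
  have hn1 : (n : K) - 1 ≠ 0 := sub_ne_zero.2 (by exact_mod_cast (by omega : n ≠ 1))
  have hn2 : (n : K) - 2 ≠ 0 := sub_ne_zero.2 (by exact_mod_cast (by omega : n ≠ 2))
  have hN0 : N ≠ 0 := hN ▸ mul_ne_zero H.ne_zero (mul_ne_zero hn0 hn2)
  have hid : C N * a₂ = k * (k - a₁) := by
    rw [← H.identity, hN]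
    simp only [C_mul, C_sub, C_eq_natCast, C_ofNat]
    ring
  set d := max a₁.natDegree k.natDegree with hd
  have h₁ : a₁.natDegree ≤ d := le_max_left _ _
  have hk : k.natDegree ≤ d := le_max_right _ _
  have hka : (k - a₁).natDegree ≤ d := (natDegree_sub_le_of_le hk h₁).trans_eq (max_self d)
  have h₂ : a₂.natDegree ≤ d + d := by
    rw [← natDegree_C_mul hN0, hid]
    exact natDegree_mul_le_of_le hk hka
  have hd0 : d ≠ 0 := by omega
  have hcoeff : k.coeff d * (k.coeff d - a₁.coeff d) = 0 := by
    rw [← coeff_sub, ← coeff_mul_add_eq_of_natDegree_le hk hka, ← hid, coeff_C_mul,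
      H.coeff_eq_zero hd0 (by omega) h₁ hk h₂, mul_zero]
  have hα : a₁.coeff d ≠ 0 := by
    intro h0
    rw [h0, sub_zero, mul_self_eq_zero] at hcoeff
    rcases max_choice a₁.natDegree k.natDegree with h | h
    · rw [hd, h, coeff_natDegree, leadingCoeff_eq_zero] at h0
      exact hd0 (by rw [hd, h, h0, natDegree_zero])
    · rw [hd, h, coeff_natDegree, leadingCoeff_eq_zero] at hcoeff
      exact hd0 (by rw [hd, h, hcoeff, natDegree_zero])
  -- The coefficient of `yⁿ`, an equation for `t = g (n - 1)`.
  have ht : a₂ * g (n - 1) - derivative (g (n - 1)) = C (n : K) * a₁ - k := by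
    have h := H.succ (n - 1)
    rw [(by omega : n - 1 + 2 = n + 1), (by omega : n - 1 + 1 = n), H.top,
      H.eq_zero_of_lt _ (Nat.lt_succ_self n), Nat.cast_sub (by omega)] at h
    rw [C_eq_natCast]
    push_cast at h
    linear_combination -h
  generalize g (n - 1) = t at ht
  have hr : (C (n : K) * a₁ - k).coeff d ≠ 0 := by
    rw [coeff_sub, coeff_C_mul]
    rcases mul_eq_zero.1 hcoeff with h | h
    · rw [h, sub_zero]
      exact mul_ne_zero hn0 hα
    · rw [sub_eq_zero.1 h]
      exact fun h => mul_ne_zero hn1 hα (by linear_combination h)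
  have hr' : (C (n : K) * a₁ - k).natDegree ≤ d :=
    (natDegree_sub_le_of_le ((natDegree_C_mul_le _ _).trans h₁) hk).trans_eq (max_self d)
  have ht0 : t ≠ 0 := by
    rintro rfl
    rw [mul_zero, derivative_zero, sub_zero] at ht
    exact hr (by rw [← ht, coeff_zero])
  have hsum : a₂.natDegree + t.natDegree ≤ d := by
    by_cases htd : t.natDegree = 0
    · rwa [← ht, derivative_eq_zero.2 htd, sub_zero, natDegree_mul ha₂ ht0] at hr'
    · rw [← natDegree_mul ha₂ ht0, ← natDegree_sub_eq_left_of_natDegree_lt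
        (q := derivative t), ht]
      · exact hr'
      · rw [natDegree_mul ha₂ ht0, natDegree_derivative]
        omega
  have hka0 : k ≠ 0 ∧ k - a₁ ≠ 0 :=
    mul_ne_zero_iff.1 (hid ▸ mul_ne_zero (Polynomial.C_ne_zero.2 hN0) ha₂)
  have hsum' : a₂.natDegree = k.natDegree + (k - a₁).natDegree := by
    rw [← natDegree_mul hka0.1 hka0.2, ← hid, natDegree_C_mul hN0]
  have hlin : C N * (C (n : K) * a₁ - k) = k * (k - a₁) * t - C N * derivative t := by
    linear_combination -C N * ht + t * hid
  rcases mul_eq_zero.1 hcoeff with h | h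
  · have h3 : d ≤ (k - a₁).natDegree :=
      le_natDegree_of_ne_zero (by rwa [coeff_sub, h, zero_sub, neg_ne_zero])
    rw [eq_C_of_natDegree_eq_zero (by omega : t.natDegree = 0), derivative_C] at hlin
    obtain ⟨b, rfl⟩ : ∃ b, k = C b := ⟨_, eq_C_of_natDegree_eq_zero (by omega)⟩
    have hb : b ≠ 0 := fun h => hka0.1 (by rw [h, C_0])
    generalize t.coeff 0 = τ at hlin
    have hlin' : C (N * n + b * τ) * a₁ = C (b * (N + b * τ)) := by
      simp only [C_mul, C_add]
      linear_combination hlin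
    have e₁ := congrArg (fun p => coeff p d) hlin'
    simp only [coeff_C_mul, coeff_C_of_ne_zero hd0] at e₁
    have e₁ := (mul_eq_zero.1 e₁).resolve_right hα
    rw [e₁, C_0, zero_mul, eq_comm, C_eq_zero] at hlin'
    have e₂ := (mul_eq_zero.1 hlin').resolve_left hb
    exact mul_ne_zero hN0 hn1 (by linear_combination e₁ - e₂)
  · have h3 : d ≤ k.natDegree :=
      le_natDegree_of_ne_zero (by rwa [sub_eq_zero.1 h])
    rw [eq_C_of_natDegree_eq_zero (by omega : t.natDegree = 0), derivative_C] at hlin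
    obtain ⟨b, hb'⟩ : ∃ b, k - a₁ = C b := ⟨_, eq_C_of_natDegree_eq_zero (by omega)⟩
    have hb : b ≠ 0 := fun h => hka0.2 (by rw [hb', h, C_0])
    obtain rfl : k = a₁ + C b := by rw [← hb']; ring
    generalize t.coeff 0 = τ at hlin
    have hlin' : C (N * (n - 1) - b * τ) * a₁ = C (b * (N + b * τ)) := by
      rw [hb'] at hlin
      simp only [C_mul, C_add, C_sub, C_1]
      linear_combination hlin
    have e₁ := congrArg (fun p => coeff p d) hlin'
    simp only [coeff_C_mul, coeff_C_of_ne_zero hd0] at e₁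
    have e₁ := (mul_eq_zero.1 e₁).resolve_right hα
    rw [e₁, C_0, zero_mul, eq_comm, C_eq_zero] at hlin'
    have e₂ := (mul_eq_zero.1 hlin').resolve_left hb
    exact mul_ne_zero hN0 hn0 (by linear_combination e₁ + e₂)

end QuadraticCase

end InvariantCoeffs

end Recurrence

/-! ### The criterion -/

section Sufficiency

open Polynomial Polynomial.Bivariate

variable {K : Type*} [Field K] [CharZero K]

theorem invariantCoeffs_coeff {c : K} (hc : c ≠ 0) {a₁ a₂ k : K[X]} {f : K[X][Y]}
    (hf : f.Monic) (hirr : Irreducible f)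
    (h : bivariateDerivation (C c) a₁ a₂ f = f * (C (f.natDegree * a₂) * X + C k)) :
    InvariantCoeffs c a₁ a₂ k f.natDegree f.coeff where
  ne_zero := hc
  zero := coeff_one_of_cofactor h
  succ := coeff_add_two_of_cofactor h
  top := hf.coeff_natDegree
  eq_zero_of_lt _ := coeff_eq_zero_of_natDegree_lt
  identity := cofactor_identity hc hf hirr h

theorem isSimpleDerivation_bivariateDerivation {c : K} (hc : c ≠ 0) {a₁ a₂ : K[X]}
    (hdeg : a₁.natDegree ≠ 0 ∨ a₂.natDegree ≠ 0)
    (hl : ¬ ∃ l : K, l ≠ 0 ∧ a₂ = C l * a₁ - C (l ^ 2) * C c) :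
    IsSimpleDerivation (bivariateDerivation (C c) a₁ a₂) := by
  let _ : Algebra ℚ K[X][Y] := ((algebraMap K K[X][Y]).comp (algebraMap ℚ K)).toAlgebra
  refine isSimpleDerivation_of_isPrime _ fun P hP hs => ?_
  by_contra hP0
  obtain ⟨f, hf, hirr, hdvd⟩ := exists_monic_irreducible_dvd hc hP hP0 hs
  obtain ⟨k, hk⟩ := exists_cofactor hf hdvd
  have H := invariantCoeffs_coeff hc hf hirr hk
  have hn : f.natDegree ≠ 0 := fun h0 =>
    hirr.not_isUnit (hf.natDegree_eq_zero.1 h0 ▸ isUnit_one)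
  generalize f.natDegree = n at H hn
  rcases (by omega : n = 1 ∨ 2 ≤ n) with rfl | h2
  · exact hl H.exists_of_eq_one
  by_cases ha₂ : a₂ = 0
  · subst ha₂
    exact H.false_of_eq_zero (hdeg.resolve_right fun h => h natDegree_zero) h2
  rcases h2.eq_or_lt with rfl | h3
  · exact H.false_of_eq_two ha₂ hdeg
  · exact H.false_of_three_le h3 ha₂ hdeg

end Sufficiency

theorem theorem4p2 {K : Type*} [Field K] [CharZero K] (a₀ a₁ a₂ : Polynomial K) :
    IsSimpleDerivation (quadraticDerivation a₀ a₁ a₂) ↔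
      (∃ c : K, c ≠ 0 ∧ a₀ = Polynomial.C c) ∧
      (1 ≤ a₁.degree ∨ 1 ≤ a₂.degree) ∧
      ¬ ∃ l : K, l ≠ 0 ∧ a₂ = Polynomial.C l * a₁ - Polynomial.C (l ^ 2) * a₀ := by
  rw [isSimpleDerivation_quadraticDerivation_iff]
  constructor
  · intro hD
    obtain ⟨c, hc, rfl⟩ := exists_eq_C_of_isSimpleDerivation hD
    exact ⟨⟨c, hc, rfl⟩, one_le_degree_of_isSimpleDerivation hc hD,
      fun ⟨_, hl, h⟩ => ne_of_isSimpleDerivation hl hD h⟩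
  · rintro ⟨⟨c, hc, rfl⟩, hdeg, hl⟩
    have hnat (p : Polynomial K) (hp : 1 ≤ p.degree) : p.natDegree ≠ 0 :=
      Nat.one_le_iff_ne_zero.1 (Polynomial.le_natDegree_of_coe_le_degree hp)
    exact isSimpleDerivation_bivariateDerivation hc (hdeg.imp (hnat a₁) (hnat a₂)) hl
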